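/- Let $M$ be a smooth manifold (finite-dimensional, Hausdorff, $\sigma$-compact, without boundary) and let $(A,[\cdot,\cdot],\rho)$ be a Lie algebroid over $M$: a smooth real vector bundle $A\to M$ of finite rank with a Lie bracket on $\Gamma(A)$ and an anchor $\rho:A\to TM$ such that $[X,fY]=f[X,Y]+(\rho(X)\cdot f)Y$ and $\rho[X,Y]=[\rho(X),\rho(Y)]$. Assume that $A$ and $M$ are orientable, i.e. that there are non-vanishing sections $\eta\in\Gamma(\wedge^{\mathrm{top}}A)$ and $\mu\in\Omega^{\mathrm{top}}(M)$. Write $d_A$ for the Lie algebroid differential, so $(d_Af)(X)=\rho(X)\cdot f$ and $(d_A\alpha)(X,Y)=\rho(X)\cdot\alpha(Y)-\rho(Y)\cdot\alpha(X)-\alpha([X,Y])$, and $H^1(A)$ for the closed forms in $\Omega^1(A)=\Gamma(A^*)$ modulo the exact ones. The modular form of $A$ with respect to $\eta\otimes\mu$ is the form $\xi_A\in\Omega^1(A)$ determined by $$\langle\xi_A,X\rangle\,\eta\otimes\mu=\mathcal L_X\eta\otimes\mu+\eta\otimes\mathcal L_{\rho(X)}\mu ,\qquad X\in\Gamma(A),$$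 and the modular class of $A$ is $\operatorname{mod}A=[\xi_A]\in H^1(A)$. For a Lie algebroid morphism $\phi:A\to B$ over the identity of $M$ (between Lie algebroids for which the modular classes are defined), the relative modular class is $\operatorname{mod}^{\phi}(A,B)=\operatorname{mod}A-\phi^*\operatorname{mod}B\in H^1(A)$. Let $N:A\to A$ be a Nijenhuis operator, i.e. a smooth bundle map over the identity such that $N[X,Y]_N=[NX,NY]$ for all $X,Y\in\Gamma(A)$, where $[X,Y]_N=[NX,Y]+[X,NY]-N[X,Y]$, and let $A_N=(A,[\cdot,\cdot]_N,\rho\circ N)$ be the deformed Lie algebroid, so that $N:A_N\to A$ is a Lie algebroid morphism. Then: 1. The $1$-form $d_A\operatorname{Tr}N$ is $d_{A_N}$-closed, and it represents the relative modular class of $N:A_N\to A$: $$\operatorname{mod}^N(A_N,A)=[d_A\operatorname{Tr}N]\in H^1(A_N).$$ 2. This representative is canonical. For all non-vanishing $\eta\in\Gamma(\wedge^{\mathrm{top}}A)$ and $\mu\in\Omega^{\mathrm{top}}(M)$, the modular forms $\xi_A$ and $\xi_{A_N}$ of $A$ and of $A_N$ with respect to $\eta\otimes\mu$ exist, are unique,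 are closed for $d_A$ and $d_{A_N}$ respectively, represent $\operatorname{mod}A$ and $\operatorname{mod}A_N$ (which therefore do not depend on $\eta$ and $\mu$), and satisfy $$\xi_{A_N}-N^*\xi_A=d_A\operatorname{Tr}N .$$ -/

import Mathlib

set_option maxSynthPendingDepth 3

open scoped Manifold ContDiff TensorProduct
open Bundle Module

noncomputable section

namespace ModularLieAlgebroid

/-! ### Smooth functions, sections and bundle maps -/

section Basic

/-- The ring `C^∞(M)` of smooth real functions. -/
abbrev Smooth (E : Type*) [NormedAddCommGroup E] [NormedSpace ℝ E]
    (M : Type*) [TopologicalSpace M] [ChartedSpace E M] : Type _ :=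
  C^∞⟮𝓘(ℝ, E), M; ℝ⟯

/-- The space `Γ(V)` of global smooth sections of a vector bundle `V → M` with typical fibre `F`. -/
abbrev Sec (E : Type*) [NormedAddCommGroup E] [NormedSpace ℝ E]
    {M : Type*} [TopologicalSpace M] [ChartedSpace E M]
    (F : Type*) [NormedAddCommGroup F] [NormedSpace ℝ F]
    (V : M → Type*) [TopologicalSpace (TotalSpace F V)] [∀ x, TopologicalSpace (V x)]
    [FiberBundle F V] : Type _ :=
  Cₛ^∞⟮𝓘(ℝ, E); F, V⟯

/-- Smooth vector fields on `M`. -/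
abbrev VField (E : Type*) [NormedAddCommGroup E] [NormedSpace ℝ E]
    (M : Type*) [TopologicalSpace M] [ChartedSpace E M] [IsManifold 𝓘(ℝ, E) ∞ M] : Type _ :=
  Sec E E (TangentSpace 𝓘(ℝ, E) : M → Type _)

variable {E : Type*} [NormedAddCommGroup E] [NormedSpace ℝ E]
  {M : Type*} [TopologicalSpace M] [ChartedSpace E M]
  {F : Type*} [NormedAddCommGroup F] [NormedSpace ℝ F]
  {V : M → Type*} [TopologicalSpace (TotalSpace F V)] [∀ x, AddCommGroup (V x)]
  [∀ x, Module ℝ (V x)] [∀ x, TopologicalSpace (V x)] [FiberBundle F V] [VectorBundle ℝ F V]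
  {F' : Type*} [NormedAddCommGroup F'] [NormedSpace ℝ F']
  {W : M → Type*} [TopologicalSpace (TotalSpace F' W)] [∀ x, AddCommGroup (W x)]
  [∀ x, Module ℝ (W x)] [∀ x, TopologicalSpace (W x)] [FiberBundle F' W] [VectorBundle ℝ F' W]

instance Sec.instSMulSmooth : SMul (Smooth E M) (Sec E F V) :=
  ⟨fun f s => ⟨fun x => f x • s x, f.contMDiff.smul_section s.contMDiff⟩⟩

@[simp] theorem Sec.smul_apply (f : Smooth E M) (s : Sec E F V) (x : M) :
    (f • s) x = f x • s x := rfl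

/-- `Γ(V)` is a module over `C^∞(M)`, with pointwise operations. -/
instance Sec.instModuleSmooth : Module (Smooth E M) (Sec E F V) where
  one_smul s := by ext x; exact one_smul ℝ (s x)
  mul_smul f g s := by ext x; exact mul_smul (f x) (g x) (s x)
  smul_zero f := by ext x; exact smul_zero (f x)
  zero_smul s := by ext x; exact zero_smul ℝ (s x)
  smul_add f s t := by ext x; exact smul_add (f x) (s x) (t x)
  add_smul f g s := by ext x; exact add_smul (f x) (g x) (s x)

variable (E F V F' W) in
/-- A smooth map of vector bundles `V → W` over the identity of `M`. -/
structure BundleMap where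
  /-- the linear maps between the fibres -/
  toFun : ∀ x, V x →ₗ[ℝ] W x
  /-- the induced map of total spaces is smooth -/
  contMDiff_toFun : ContMDiff (𝓘(ℝ, E).prod 𝓘(ℝ, F)) (𝓘(ℝ, E).prod 𝓘(ℝ, F')) ∞
    (fun p : TotalSpace F V => (⟨p.1, toFun p.1 p.2⟩ : TotalSpace F' W))

/-- The map `Γ(V) → Γ(W)` induced by a bundle map. -/
def BundleMap.onSec (φ : BundleMap E F V F' W) : Sec E F V →ₗ[Smooth E M] Sec E F' W where
  toFun s := ⟨fun x => φ.toFun x (s x), φ.contMDiff_toFun.comp s.contMDiff⟩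
  map_add' s t := by ext x; exact map_add (φ.toFun x) (s x) (t x)
  map_smul' f s := by ext x; exact map_smul (φ.toFun x) (f x) (s x)

@[simp] theorem BundleMap.onSec_apply (φ : BundleMap E F V F' W) (s : Sec E F V) (x : M) :
    φ.onSec s x = φ.toFun x (s x) := rfl

theorem BundleMap.onSec_real_smul (φ : BundleMap E F V F' W) (c : ℝ) (s : Sec E F V) :
    φ.onSec (c • s) = c • φ.onSec s := by
  ext x
  exact map_smul (φ.toFun x) c (s x)

/-- The smooth function `Tr N` of a bundle endomorphism `N`: the trace in each fibre. -/
def BundleMap.trace [FiniteDimensional ℝ F] [ContMDiffVectorBundle ∞ F V 𝓘(ℝ, E)]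
    (N : BundleMap E F V F V) : Smooth E M :=
  ⟨fun x => LinearMap.trace ℝ (V x) (N.toFun x), by
    intro x
    let e := trivializationAt F V x
    let b := Module.finBasis ℝ F
    have hx : x ∈ e.baseSet := FiberBundle.mem_baseSet_trivializationAt' x
    have hs : ∀ i, ContMDiffAt 𝓘(ℝ, E) (𝓘(ℝ, E).prod 𝓘(ℝ, F)) ∞
        (fun y => (⟨y, N.toFun y (e.localFrame b i y)⟩ : TotalSpace F V)) x := fun i =>
      (N.contMDiff_toFun _).comp x (contMDiffAt_localFrame_of_mem ∞ e b i hx)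
    have hsum : ContMDiffAt 𝓘(ℝ, E) 𝓘(ℝ, ℝ) ∞
        (fun y => ∑ i, e.localFrameCoeff 𝓘(ℝ, E) b i y (N.toFun y (e.localFrame b i y))) x := by
      apply ContMDiffAt.sum
      intro i _
      exact contMDiffAt_localFrameCoeff b hx (hs i) i
    refine hsum.congr_of_eventuallyEq ?_
    filter_upwards [e.open_baseSet.mem_nhds hx] with y hy
    rw [LinearMap.trace_eq_matrix_trace ℝ (e.basisAt b hy), Matrix.trace]
    refine Finset.sum_congr rfl fun i _ => ?_
    rw [Matrix.diag_apply, LinearMap.toMatrix_apply,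
      e.localFrameCoeff_apply_of_mem_baseSet b hy
        (fun y => N.toFun y (e.localFrame b i y)) i,
      e.localFrame_apply_of_mem_baseSet b hy]⟩

section VectorFields

variable [IsManifold 𝓘(ℝ, E) ∞ M]

/-- The derivative `Z · f` of a smooth function along a vector field, as a derivation. -/
def VField.act (Z : VField E M) : Derivation ℝ (Smooth E M) (Smooth E M) :=
  Derivation.mk'
    { toFun := fun f => ⟨fun x => mfderiv 𝓘(ℝ, E) 𝓘(ℝ, ℝ) f x (Z x), by
        have h1 := (f.contMDiff.contMDiff_tangentMap (m := ∞) (by simp)).comp Z.contMDiff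
        intro x
        have h2 := (contMDiffAt_totalSpace.1 (h1 x)).2
        simpa [tangentMap] using h2⟩
      map_add' := fun f g => by
        ext x
        have hf := f.contMDiff.mdifferentiable (by simp) x
        have hg := g.contMDiff.mdifferentiable (by simp) x
        exact congrArg (fun L => L (Z x)) (mfderiv_add hf hg)
      map_smul' := fun c f => by
        ext x
        have hf := f.contMDiff.mdifferentiable (by simp) x
        exact congrArg (fun L => L (Z x)) (const_smul_mfderiv hf c) }
    (fun f g => by
      ext x
      have hf := f.contMDiff.mdifferentiable (by simp) x
      have hg := g.contMDiff.mdifferentiable (by simp) x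
      exact congrArg (fun L => L (Z x)) (hf.hasMFDerivAt.mul hg.hasMFDerivAt).mfderiv)

@[simp] theorem VField.act_apply (Z : VField E M) (f : Smooth E M) (x : M) :
    Z.act f x = mfderiv 𝓘(ℝ, E) 𝓘(ℝ, ℝ) f x (Z x) := rfl

theorem VField.add_act (Z Z' : VField E M) (f : Smooth E M) :
    (Z + Z').act f = Z.act f + Z'.act f := by
  ext x
  exact map_add (mfderiv 𝓘(ℝ, E) 𝓘(ℝ, ℝ) f x) (Z x) (Z' x)

theorem VField.smul_act (g : Smooth E M) (Z : VField E M) (f : Smooth E M) :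
    (g • Z).act f = g * Z.act f := by
  ext x
  exact map_smul (mfderiv 𝓘(ℝ, E) 𝓘(ℝ, ℝ) f x) (g x) (Z x)

variable [CompleteSpace E]

/-- The Lie bracket of smooth vector fields. -/
def VField.bracket (Z : VField E M) : VField E M →ₗ[ℝ] VField E M where
  toFun Z' := ⟨VectorField.mlieBracket 𝓘(ℝ, E) Z Z', by
    have : IsManifold 𝓘(ℝ, E) (((⊤ : ℕ∞) : WithTop ℕ∞) + 1) M := by
      simpa using (inferInstance : IsManifold 𝓘(ℝ, E) ∞ M)
    have : IsManifold 𝓘(ℝ, E) (minSmoothness ℝ 2) M := by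
      simpa using (inferInstance : IsManifold 𝓘(ℝ, E) 2 M)
    exact ContDiff.mlieBracket_vectorField (m := ⊤) (n := ⊤) Z.contMDiff Z'.contMDiff (by simp)⟩
  map_add' Z₁ Z₂ := by
    ext x
    exact VectorField.mlieBracket_add_right Z₁.mdifferentiableAt Z₂.mdifferentiableAt
  map_smul' c Z₁ := by
    ext x
    exact VectorField.mlieBracket_const_smul_right Z₁.mdifferentiableAt

@[simp] theorem VField.bracket_apply (Z Z' : VField E M) (x : M) :
    Z.bracket Z' x = VectorField.mlieBracket 𝓘(ℝ, E) Z Z' x := rfl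

theorem VField.bracket_smul (Z : VField E M) (f : Smooth E M) (Z' : VField E M) :
    Z.bracket (f • Z') = f • Z.bracket Z' + Z.act f • Z' := by
  ext x
  have h := VectorField.mlieBracket_smul_right (V := Z) (W := Z')
    (f.contMDiff.mdifferentiable (by simp) x) (Z'.mdifferentiableAt (x := x))
  refine h.trans (add_comm _ _)

end VectorFields

end Basic

/-! ### Extending a derivation to alternating tensors -/

section Tensor

variable {R : Type*} [CommRing R] [Algebra ℝ R] {G : Type*} [AddCommGroup G] [Module R G]
  [Module ℝ G] {ι : Type*} [Fintype ι] [inst₀ : DecidableEq ι]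

/-- Let `D` be a derivation of the `R`-module `G` over the derivation `δ` of `R`. The induced
derivation of alternating tensors is
`(D w)(Y₁, …, Yₖ) = δ (w(Y₁, …, Yₖ)) - ∑ i, w(Y₁, …, D Yᵢ, …, Yₖ)`. -/
def derivAlternating (δ : Derivation ℝ R R) (D : G →ₗ[ℝ] G)
    (hD : ∀ (f : R) (s : G), D (f • s) = f • D s + δ f • s) (w : G [⋀^ι]→ₗ[R] R) :
    G [⋀^ι]→ₗ[R] R where
  toFun Y := δ (w Y) - ∑ i, w (Function.update Y i (D (Y i)))
  map_update_add' {inst} Y j a b := by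
    rw [Subsingleton.elim inst inst₀]
    clear inst
    have hsum : ∀ i, w (Function.update (Function.update Y j (a + b)) i
          (D (Function.update Y j (a + b) i))) =
        w (Function.update (Function.update Y j a) i (D (Function.update Y j a i))) +
        w (Function.update (Function.update Y j b) i (D (Function.update Y j b i))) := by
      intro i
      by_cases h : i = j
      · subst h
        simp
      · simp only [Function.update_of_ne h, Function.update_comm (Ne.symm h), w.map_update_add]
    simp only [hsum, w.map_update_add, map_add, Finset.sum_add_distrib]
    abel
  map_update_smul' {inst} Y j c a := by
    rw [Subsingleton.elim inst inst₀]
    clear inst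
    have hsum : ∀ i, w (Function.update (Function.update Y j (c • a)) i
          (D (Function.update Y j (c • a) i))) =
        c * w (Function.update (Function.update Y j a) i (D (Function.update Y j a i))) +
        if i = j then δ c * w (Function.update Y j a) else 0 := by
      intro i
      by_cases h : i = j
      · subst h
        simp [hD]
      · simp only [Function.update_of_ne h, Function.update_comm (Ne.symm h), w.map_update_smul,
          if_neg h, add_zero, smul_eq_mul]
    simp only [hsum, w.map_update_smul, smul_eq_mul, Derivation.leibniz, Finset.sum_add_distrib,
      ← Finset.mul_sum, Finset.sum_ite_eq', Finset.mem_univ, if_true]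
    ring
  map_eq_zero_of_eq' Y i j hY hij := by
    have hz : ∀ k, k ≠ i → k ≠ j → w (Function.update Y k (D (Y k))) = 0 := fun k hi hj =>
      w.map_eq_zero_of_eq _ (by
        rw [Function.update_of_ne hi.symm, Function.update_of_ne hj.symm, hY]) hij
    have hswap : w (Function.update Y j (D (Y j))) = -w (Function.update Y i (D (Y i))) := by
      rw [← w.map_swap _ hij]
      congr 1
      funext k
      by_cases hi : k = i
      · subst hi
        simp [Function.update_of_ne hij, Function.update_of_ne hij.symm, hY]
      · by_cases hj : k = j
        · subst hj
          simp [hY]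
        · simp [Equiv.swap_apply_of_ne_of_ne hi hj, Function.update_of_ne hi,
            Function.update_of_ne hj]
    rw [w.map_eq_zero_of_eq Y hY hij, map_zero,
      Finset.sum_eq_add i j hij (fun k _ hk => hz k hk.1 hk.2) (by simp) (by simp), hswap]
    simp

end Tensor

/-! ### Lie algebroids -/

section Algebroid

variable (E : Type*) [NormedAddCommGroup E] [NormedSpace ℝ E] [CompleteSpace E]
  {M : Type*} [TopologicalSpace M] [ChartedSpace E M] [IsManifold 𝓘(ℝ, E) ∞ M]
  (F : Type*) [NormedAddCommGroup F] [NormedSpace ℝ F]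
  (V : M → Type*) [TopologicalSpace (TotalSpace F V)] [∀ x, AddCommGroup (V x)]
  [∀ x, Module ℝ (V x)] [∀ x, TopologicalSpace (V x)] [FiberBundle F V] [VectorBundle ℝ F V]
  (F' : Type*) [NormedAddCommGroup F'] [NormedSpace ℝ F']
  (W : M → Type*) [TopologicalSpace (TotalSpace F' W)] [∀ x, AddCommGroup (W x)]
  [∀ x, Module ℝ (W x)] [∀ x, TopologicalSpace (W x)] [FiberBundle F' W] [VectorBundle ℝ F' W]

/-- A Lie algebroid structure on the vector bundle `V → M`. -/
structure LieAlgebroid where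
  /-- the anchor `ρ : V → TM` -/
  anchor : BundleMap E F V E (TangentSpace 𝓘(ℝ, E) : M → Type _)
  /-- the bracket on `Γ(V)` -/
  bracket : Sec E F V →ₗ[ℝ] Sec E F V →ₗ[ℝ] Sec E F V
  bracket_self : ∀ X, bracket X X = 0
  jacobi : ∀ X Y Z,
    bracket X (bracket Y Z) = bracket (bracket X Y) Z + bracket Y (bracket X Z)
  anchor_bracket : ∀ X Y,
    anchor.onSec (bracket X Y) = VField.bracket (anchor.onSec X) (anchor.onSec Y)
  leibniz : ∀ (X : Sec E F V) (f : Smooth E M) (Y : Sec E F V),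
    bracket X (f • Y) = f • bracket X Y + VField.act (anchor.onSec X) f • Y

/-- `A`-differential forms of degree one: smooth sections of the dual bundle `A*`. By tensoriality
these are the same as `C^∞(M)`-linear functions of a section of `A`. -/
abbrev OneForm : Type _ := Sec E F V →ₗ[Smooth E M] Smooth E M

/-- `A`-multivector fields of top degree: smooth sections of `⋀ʳ A`, `r` the rank of `A`. By
tensoriality these are the same as `C^∞(M)`-multilinear alternating functions of `r` sections of
the dual bundle. -/
abbrev TopMultivector : Type _ :=
  OneForm E F V [⋀^Fin (finrank ℝ F)]→ₗ[Smooth E M] Smooth E M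

/-- Differential forms of top degree on `M`. By tensoriality these are the same as
`C^∞(M)`-multilinear alternating functions of `dim M` vector fields. -/
abbrev TopForm (E : Type*) [NormedAddCommGroup E] [NormedSpace ℝ E]
    (M : Type*) [TopologicalSpace M] [ChartedSpace E M] [IsManifold 𝓘(ℝ, E) ∞ M] : Type _ :=
  VField E M [⋀^Fin (finrank ℝ E)]→ₗ[Smooth E M] Smooth E M

end Algebroid

section

variable {E : Type*} [NormedAddCommGroup E] [NormedSpace ℝ E] [CompleteSpace E]
  {M : Type*} [TopologicalSpace M] [ChartedSpace E M] [IsManifold 𝓘(ℝ, E) ∞ M]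
  {F : Type*} [NormedAddCommGroup F] [NormedSpace ℝ F]
  {V : M → Type*} [TopologicalSpace (TotalSpace F V)] [∀ x, AddCommGroup (V x)]
  [∀ x, Module ℝ (V x)] [∀ x, TopologicalSpace (V x)] [FiberBundle F V] [VectorBundle ℝ F V]
  {F' : Type*} [NormedAddCommGroup F'] [NormedSpace ℝ F']
  {W : M → Type*} [TopologicalSpace (TotalSpace F' W)] [∀ x, AddCommGroup (W x)]
  [∀ x, Module ℝ (W x)] [∀ x, TopologicalSpace (W x)] [FiberBundle F' W] [VectorBundle ℝ F' W]

/-- A multivector field of top degree is non-vanishing if its value at every point is non-zero. -/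
def TopMultivector.NonVanishing (η : TopMultivector E F V) : Prop :=
  ∀ x : M, ∃ α, η α x ≠ 0

/-- A form of top degree is non-vanishing if its value at every point is non-zero. -/
def TopForm.NonVanishing (μ : TopForm E M) : Prop :=
  ∀ x : M, ∃ Z, μ Z x ≠ 0

namespace LieAlgebroid

variable (A : LieAlgebroid E F V)

/-- The vector field `ρ(X)`. -/
def rho : Sec E F V →ₗ[Smooth E M] VField E M := A.anchor.onSec

theorem bracket_skew (X Y : Sec E F V) : A.bracket X Y = -A.bracket Y X := by
  have h := A.bracket_self (X + Y)
  simp only [map_add, LinearMap.add_apply, A.bracket_self, zero_add, add_zero] at h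
  exact eq_neg_of_add_eq_zero_right h

theorem smul_bracket (f : Smooth E M) (X Y : Sec E F V) :
    A.bracket (f • X) Y = f • A.bracket X Y - (A.rho Y).act f • X := by
  rw [A.bracket_skew, A.leibniz, A.bracket_skew Y X]
  simp only [rho, smul_neg]
  abel

theorem bracket_smul (X : Sec E F V) (f : Smooth E M) (Y : Sec E F V) :
    A.bracket X (f • Y) = f • A.bracket X Y + (A.rho X).act f • Y := A.leibniz X f Y

/-- The differential of functions, `(d_A f)(X) = ρ(X) · f`. -/
def dZero : Smooth E M →ₗ[ℝ] OneForm E F V where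
  toFun f :=
    { toFun := fun X => (A.rho X).act f
      map_add' := fun X Y => by rw [map_add, VField.add_act]
      map_smul' := fun g X => by rw [map_smul, VField.smul_act]; rfl }
  map_add' f g := by ext X : 1; exact map_add (A.rho X).act f g
  map_smul' c f := by ext X : 1; exact (A.rho X).act.map_smul c f

/-- The differential of one-forms,
`(d_A α)(X, Y) = ρ(X) · α(Y) - ρ(Y) · α(X) - α([X, Y])`. -/
def dOne : OneForm E F V →ₗ[ℝ] Sec E F V →ₗ[Smooth E M] OneForm E F V where
  toFun α := LinearMap.mk₂ (Smooth E M)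
    (fun X Y => (A.rho X).act (α Y) - (A.rho Y).act (α X) - α (A.bracket X Y))
    (fun X X' Y => by
      simp only [map_add, LinearMap.add_apply, VField.add_act]
      abel)
    (fun f X Y => by
      simp only [map_smul, map_sub, A.smul_bracket, VField.smul_act, smul_eq_mul,
        Derivation.leibniz]
      ring)
    (fun X Y Y' => by
      simp only [map_add, VField.add_act]
      abel)
    (fun f X Y => by
      simp only [map_smul, map_add, A.bracket_smul, VField.smul_act, smul_eq_mul,
        Derivation.leibniz]
      ring)
  map_add' α β := by
    refine LinearMap.ext fun X => LinearMap.ext fun Y => ?_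
    simp only [LinearMap.mk₂_apply, LinearMap.add_apply, map_add]
    abel
  map_smul' c α := by
    refine LinearMap.ext fun X => LinearMap.ext fun Y => ?_
    simp only [LinearMap.mk₂_apply, LinearMap.smul_apply, Derivation.map_smul, RingHom.id_apply,
      smul_sub]

@[simp] theorem dOne_apply (α : OneForm E F V) (X Y : Sec E F V) :
    A.dOne α X Y = (A.rho X).act (α Y) - (A.rho Y).act (α X) - α (A.bracket X Y) := rfl

/-- Closed `A`-forms of degree one. -/
def closedForms : Submodule ℝ (OneForm E F V) := LinearMap.ker A.dOne

/-- Exact `A`-forms of degree one. -/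
def exactForms : Submodule ℝ (OneForm E F V) := LinearMap.range A.dZero

/-- The first Lie algebroid cohomology space `H¹(A)`. -/
abbrev H1 : Type _ := A.closedForms ⧸ A.exactForms.submoduleOf A.closedForms

/-- The cohomology class of a closed one-form. -/
def cls (ξ : A.closedForms) : A.H1 := Submodule.Quotient.mk ξ

/-- The Lie derivative of one-forms, `(L_X α)(Y) = ρ(X) · α(Y) - α([X, Y])`. -/
def lieOneForm (X : Sec E F V) : OneForm E F V →ₗ[ℝ] OneForm E F V where
  toFun α :=
    { toFun := fun Y => (A.rho X).act (α Y) - α (A.bracket X Y)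
      map_add' := fun Y Y' => by
        simp only [map_add]
        abel
      map_smul' := fun f Y => by
        simp only [map_smul, map_add, A.bracket_smul, smul_eq_mul, Derivation.leibniz,
          RingHom.id_apply]
        ring }
  map_add' α β := by
    ext Y : 1
    simp only [LinearMap.coe_mk, AddHom.coe_mk, LinearMap.add_apply, map_add]
    abel
  map_smul' c α := by
    ext Y : 1
    simp only [LinearMap.coe_mk, AddHom.coe_mk, LinearMap.smul_apply, Derivation.map_smul,
      RingHom.id_apply, smul_sub]

@[simp] theorem lieOneForm_apply (X : Sec E F V) (α : OneForm E F V) (Y : Sec E F V) :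
    A.lieOneForm X α Y = (A.rho X).act (α Y) - α (A.bracket X Y) := rfl

theorem lieOneForm_smul (X : Sec E F V) (f : Smooth E M) (α : OneForm E F V) :
    A.lieOneForm X (f • α) = f • A.lieOneForm X α + (A.rho X).act f • α := by
  ext Y : 1
  simp only [lieOneForm_apply, LinearMap.smul_apply, LinearMap.add_apply, smul_eq_mul,
    Derivation.leibniz]
  ring

/-- The Lie derivative `L_X η = [X, η]` of multivector fields of top degree, i.e.
`(L_X η)(α₁, …, αᵣ) = ρ(X) · η(α₁, …, αᵣ) - ∑ i, η(α₁, …, L_X αᵢ, …, αᵣ)`. -/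
def lieTop (X : Sec E F V) (η : TopMultivector E F V) : TopMultivector E F V :=
  derivAlternating (A.rho X).act (A.lieOneForm X) (A.lieOneForm_smul X) η

end LieAlgebroid

/-- The Lie derivative of forms of top degree along a vector field,
`(L_Z μ)(Z₁, …, Zₙ) = Z · μ(Z₁, …, Zₙ) - ∑ i, μ(Z₁, …, [Z, Zᵢ], …, Zₙ)`. -/
def lieTopForm (Z : VField E M) (μ : TopForm E M) : TopForm E M :=
  derivAlternating Z.act Z.bracket Z.bracket_smul μ

namespace LieAlgebroid

variable (A : LieAlgebroid E F V) (B : LieAlgebroid E F' W)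

/-- `ξ` is the modular form of `A` with respect to `η ⊗ μ`:
`⟨ξ, X⟩ η ⊗ μ = L_X η ⊗ μ + η ⊗ L_{ρ(X)} μ` for every section `X` of `A`. -/
def IsModularForm (η : TopMultivector E F V) (μ : TopForm E M) (ξ : OneForm E F V) : Prop :=
  ∀ X : Sec E F V, ξ X • (η ⊗ₜ[Smooth E M] μ) =
    (A.lieTop X η) ⊗ₜ[Smooth E M] μ + η ⊗ₜ[Smooth E M] (lieTopForm (A.rho X) μ)

/-- The class `c` is represented by a modular form of `A`. -/
def IsModularClass (c : A.H1) : Prop :=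
  ∃ (η : TopMultivector E F V) (μ : TopForm E M) (ξ : A.closedForms),
    η.NonVanishing ∧ μ.NonVanishing ∧ A.IsModularForm η μ ξ ∧ c = A.cls ξ

open Classical in
/-- The modular class of `A`: the class of the modular form with respect to any choice of
non-vanishing `η` and `μ` (and, by convention, zero if there is no such choice). -/
def modularClass : A.H1 := if h : ∃ c, A.IsModularClass c then h.choose else 0

/-- A morphism of Lie algebroids over the identity of `M`. -/
structure Hom where
  /-- the underlying bundle map -/
  toBundleMap : BundleMap E F V F' W
  anchor_comp : ∀ (x : M) (v : V x),
    B.anchor.toFun x (toBundleMap.toFun x v) = A.anchor.toFun x v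
  map_bracket : ∀ X Y : Sec E F V,
    toBundleMap.onSec (A.bracket X Y) = B.bracket (toBundleMap.onSec X) (toBundleMap.onSec Y)

end LieAlgebroid

/-- The transpose `φ* : Ω¹(W) → Ω¹(V)` of a bundle map, `(φ* α)(X) = α(φ X)`. -/
def BundleMap.pullback (φ : BundleMap E F V F' W) : OneForm E F' W →ₗ[ℝ] OneForm E F V where
  toFun α := α.comp φ.onSec
  map_add' _ _ := rfl
  map_smul' _ _ := rfl

namespace LieAlgebroid

variable {A : LieAlgebroid E F V} {B : LieAlgebroid E F' W}

theorem Hom.rho_comp (φ : Hom A B) (X : Sec E F V) :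
    B.rho (φ.toBundleMap.onSec X) = A.rho X := by
  ext x
  exact φ.anchor_comp x (X x)

theorem Hom.pullback_closed (φ : Hom A B) (α : OneForm E F' W) (hα : α ∈ B.closedForms) :
    φ.toBundleMap.pullback α ∈ A.closedForms := by
  change A.dOne (φ.toBundleMap.pullback α) = 0
  refine LinearMap.ext fun X => LinearMap.ext fun Y => ?_
  have h : B.dOne α (φ.toBundleMap.onSec X) (φ.toBundleMap.onSec Y) = 0 := by
    rw [show B.dOne α = 0 from hα]
    rfl
  rw [dOne_apply, φ.rho_comp, φ.rho_comp, ← φ.map_bracket] at h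
  exact h

theorem Hom.pullback_dZero (φ : Hom A B) (f : Smooth E M) :
    φ.toBundleMap.pullback (B.dZero f) = A.dZero f := by
  ext X : 1
  exact congrArg (fun Z => VField.act Z f) (φ.rho_comp X)

/-- The pull-back of closed one-forms along a morphism. -/
def Hom.pullbackClosed (φ : Hom A B) : B.closedForms →ₗ[ℝ] A.closedForms :=
  φ.toBundleMap.pullback.restrict φ.pullback_closed

/-- The map `φ* : H¹(B) → H¹(A)` induced by a morphism `φ : A → B`. -/
def Hom.pullbackH1 (φ : Hom A B) : B.H1 →ₗ[ℝ] A.H1 :=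
  Submodule.mapQ _ _ φ.pullbackClosed (by
    rintro ⟨α, hα⟩ ⟨f, hf⟩
    exact ⟨f, (φ.pullback_dZero f).symm.trans (congrArg φ.toBundleMap.pullback hf)⟩)

/-- The relative modular class `mod A - φ* (mod B)` of a morphism `φ : A → B`. -/
def Hom.relativeModularClass (φ : Hom A B) : A.H1 :=
  A.modularClass - φ.pullbackH1 B.modularClass

variable (A)

/-- The deformed bracket `[X, Y]_N = [N X, Y] + [X, N Y] - N [X, Y]`. -/
def deformedBracket (N : BundleMap E F V F V) :
    Sec E F V →ₗ[ℝ] Sec E F V →ₗ[ℝ] Sec E F V :=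
  LinearMap.mk₂ ℝ
    (fun X Y => A.bracket (N.onSec X) Y + A.bracket X (N.onSec Y) - N.onSec (A.bracket X Y))
    (fun X X' Y => by
      simp only [map_add, LinearMap.add_apply]
      abel)
    (fun c X Y => by
      simp only [BundleMap.onSec_real_smul, map_smul, LinearMap.smul_apply, smul_sub, smul_add])
    (fun X Y Y' => by
      simp only [map_add]
      abel)
    (fun c X Y => by
      simp only [BundleMap.onSec_real_smul, map_smul, smul_sub, smul_add])

@[simp] theorem deformedBracket_apply (N : BundleMap E F V F V) (X Y : Sec E F V) :
    A.deformedBracket N X Y =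
      A.bracket (N.onSec X) Y + A.bracket X (N.onSec Y) - N.onSec (A.bracket X Y) := rfl

theorem bracket_skew_deformed (N : BundleMap E F V F V) (X Y : Sec E F V) :
    A.deformedBracket N X Y = -A.deformedBracket N Y X := by
  simp only [deformedBracket_apply]
  rw [A.bracket_skew X Y, A.bracket_skew (N.onSec X) Y, A.bracket_skew X (N.onSec Y), map_neg]
  abel

/-- A bundle map `N : A → A` is a Nijenhuis operator if its torsion
`T_N(X, Y) = N [X, Y]_N - [N X, N Y]` vanishes. -/
def IsNijenhuis (N : BundleMap E F V F V) : Prop :=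
  ∀ X Y : Sec E F V,
    N.onSec (A.deformedBracket N X Y) - A.bracket (N.onSec X) (N.onSec Y) = 0

/-- The bundle map `ρ ∘ N`. -/
def deformedAnchor (N : BundleMap E F V F V) :
    BundleMap E F V E (TangentSpace 𝓘(ℝ, E) : M → Type _) where
  toFun x := (A.anchor.toFun x).comp (N.toFun x)
  contMDiff_toFun := A.anchor.contMDiff_toFun.comp N.contMDiff_toFun

/-- The deformed Lie algebroid `A_N = (A, [ , ]_N, ρ ∘ N)` of a Nijenhuis operator `N`. -/
def deform (N : BundleMap E F V F V) (hN : A.IsNijenhuis N) : LieAlgebroid E F V where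
  anchor := A.deformedAnchor N
  bracket := A.deformedBracket N
  bracket_self X := by
    rw [deformedBracket_apply, A.bracket_skew X (N.onSec X), A.bracket_self, map_zero]
    abel
  jacobi X Y Z := by
    have key : ∀ X Y Z, A.deformedBracket N X (A.deformedBracket N Y Z) =
        A.bracket (N.onSec X) (A.bracket (N.onSec Y) Z) +
        A.bracket (N.onSec X) (A.bracket Y (N.onSec Z)) +
        A.bracket X (A.bracket (N.onSec Y) (N.onSec Z)) -
        N.onSec (A.bracket X (A.bracket (N.onSec Y) Z) + A.bracket X (A.bracket Y (N.onSec Z)) +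
          A.bracket (N.onSec X) (A.bracket Y Z)) +
        N.onSec (N.onSec (A.bracket X (A.bracket Y Z))) := by
      intro X Y Z
      have h1 : N.onSec (A.deformedBracket N Y Z) = A.bracket (N.onSec Y) (N.onSec Z) :=
        sub_eq_zero.1 (hN Y Z)
      have h2 : N.onSec (A.deformedBracket N X (A.bracket Y Z)) =
          A.bracket (N.onSec X) (N.onSec (A.bracket Y Z)) :=
        sub_eq_zero.1 (hN X (A.bracket Y Z))
      rw [A.deformedBracket_apply N X (A.deformedBracket N Y Z), h1, A.deformedBracket_apply N Y Z]
      rw [A.deformedBracket_apply] at h2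
      simp only [map_add, map_sub] at h2 ⊢
      rw [← h2]
      abel
    have hJ : ∀ X Y Z, A.bracket X (A.bracket Y Z) =
        -A.bracket Z (A.bracket X Y) + A.bracket Y (A.bracket X Z) := fun X Y Z => by
      rw [A.jacobi, A.bracket_skew (A.bracket X Y) Z]
    rw [A.bracket_skew_deformed N (A.deformedBracket N X Y) Z, key, key, key]
    have e1 := hJ (N.onSec X) (N.onSec Y) Z
    have e2 := hJ (N.onSec X) Y (N.onSec Z)
    have e3 := hJ X (N.onSec Y) (N.onSec Z)
    have e4 := hJ X (N.onSec Y) Z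
    have e5 := hJ X Y (N.onSec Z)
    have e6 := hJ (N.onSec X) Y Z
    have e7 := hJ X Y Z
    rw [e1, e2, e3, e4, e5, e6, e7]
    simp only [map_add, map_neg]
    abel
  anchor_bracket X Y := by
    have h1 : N.onSec (A.deformedBracket N X Y) = A.bracket (N.onSec X) (N.onSec Y) :=
      sub_eq_zero.1 (hN X Y)
    change A.anchor.onSec (N.onSec (A.deformedBracket N X Y)) =
      VField.bracket (A.anchor.onSec (N.onSec X)) (A.anchor.onSec (N.onSec Y))
    rw [h1, A.anchor_bracket]
  leibniz X f Y := by
    change A.deformedBracket N X (f • Y) = f • A.deformedBracket N X Y +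
      (A.rho (N.onSec X)).act f • Y
    simp only [deformedBracket_apply, map_smul, map_add, A.bracket_smul, smul_add, smul_sub]
    abel

/-- A Nijenhuis operator, as a morphism of Lie algebroids `N : A_N → A`. -/
def deformHom (N : BundleMap E F V F V) (hN : A.IsNijenhuis N) : Hom (A.deform N hN) A where
  toBundleMap := N
  anchor_comp _ _ := rfl
  map_bracket X Y := sub_eq_zero.1 (hN X Y)

end LieAlgebroid

end

end ModularLieAlgebroid

end

noncomputable section

namespace ModularLieAlgebroid

/-! ### Calculus of induced derivations -/

section Derivations

variable {R : Type*} [CommRing R] [Algebra ℝ R] {G : Type*} [AddCommGroup G] [Module R G]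
  [Module ℝ G] {ι : Type*} [Fintype ι] [DecidableEq ι]

/-! Since `η` and `μ` generate the modules of top degree, `L_X η = a(X) η` and `L_{ρ(X)} μ = b(X) μ`
for unique functions `a(X)`, `b(X)`, and the only candidate for the modular form is `ξ = a + b`.
Neither summand is tensorial: `a(fX) = f a(X) - ρ(X)·f` and `b(fX) = f b(X) + ρ(X)·f`, but the
defects cancel in the sum. Closedness follows from `L_{[X,Y]} = [L_X, L_Y]` on both factors, and
replacing `(η, μ)` by `(fη, gμ)` adds `d_A (log|f| + log|g|)` to `ξ`.

For the deformed algebroid, one-forms satisfy `L_{NX} = L^N_X + [L_X, N*]`. Extended as a derivation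
to top multivectors, `N*` is multiplication by `-Tr N` (`derivAlternating_pullback`), so the
commutator acts as `-ρ(X)·Tr N`. Hence `L^N_X η = L_{NX} η + (ρ(X)·Tr N) η` (`lieTop_deform`), while
the `μ`-term of `A_N` at `X` is that of `A` at `NX`. Subtracting gives `ξ_{A_N} - N*ξ_A = d_A Tr N`.

The algebra rests on `derivAlternating_commutator` and on `FrameAt.derivAlternating_zero_apply`,
which turns tensorial corrections into traces. -/

theorem derivAlternating_apply (δ : Derivation ℝ R R) (D : G →ₗ[ℝ] G)
    (hD : ∀ (f : R) (s : G), D (f • s) = f • D s + δ f • s) (w : G [⋀^ι]→ₗ[R] R) (Y : ι → G) :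
    derivAlternating δ D hD w Y = δ (w Y) - ∑ i, w (Function.update Y i (D (Y i))) := rfl

theorem derivAlternating_smul (δ : Derivation ℝ R R) (D : G →ₗ[ℝ] G)
    (hD : ∀ (f : R) (s : G), D (f • s) = f • D s + δ f • s) (f : R) (w : G [⋀^ι]→ₗ[R] R) :
    derivAlternating δ D hD (f • w) = f • derivAlternating δ D hD w + δ f • w := by
  ext Y
  simp only [derivAlternating_apply, AlternatingMap.smul_apply, AlternatingMap.add_apply,
    smul_eq_mul, Derivation.leibniz, mul_sub, Finset.mul_sum]
  ring

/-- The induced derivation is linear in the pair `(δ, D)`. The main use is with `δ₂ = 0`: the Lie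
derivatives being compared differ by a tensorial correction, which then acts through its trace. -/
theorem derivAlternating_smul_add (c : R) {δ δ₁ δ₂ : Derivation ℝ R R} {D D₁ D₂ : G →ₗ[ℝ] G}
    {hD : ∀ (f : R) (s : G), D (f • s) = f • D s + δ f • s}
    {hD₁ : ∀ (f : R) (s : G), D₁ (f • s) = f • D₁ s + δ₁ f • s}
    {hD₂ : ∀ (f : R) (s : G), D₂ (f • s) = f • D₂ s + δ₂ f • s}
    (hδ : ∀ f, δ f = c * δ₁ f + δ₂ f) (hDD : ∀ s, D s = c • D₁ s + D₂ s)
    (w : G [⋀^ι]→ₗ[R] R) :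
    derivAlternating δ D hD w = c • derivAlternating δ₁ D₁ hD₁ w + derivAlternating δ₂ D₂ hD₂ w := by
  ext Y
  simp only [derivAlternating_apply, AlternatingMap.smul_apply, AlternatingMap.add_apply,
    smul_eq_mul, hδ, hDD, w.map_update_add, w.map_update_smul, Finset.sum_add_distrib,
    ← Finset.mul_sum]
  ring

/-- Terms in which `D₁` and `D₂` hit different slots are symmetric in the two operators and cancel
(`symm`); only terms with both in the same slot survive (`inner`). -/
theorem derivAlternating_commutator {δ δ₁ δ₂ : Derivation ℝ R R} {D D₁ D₂ : G →ₗ[ℝ] G}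
    {hD : ∀ (f : R) (s : G), D (f • s) = f • D s + δ f • s}
    {hD₁ : ∀ (f : R) (s : G), D₁ (f • s) = f • D₁ s + δ₁ f • s}
    {hD₂ : ∀ (f : R) (s : G), D₂ (f • s) = f • D₂ s + δ₂ f • s}
    (hδ : ∀ f, δ f = δ₁ (δ₂ f) - δ₂ (δ₁ f)) (hDD : ∀ s, D s = D₁ (D₂ s) - D₂ (D₁ s))
    (w : G [⋀^ι]→ₗ[R] R) :
    derivAlternating δ D hD w =
      derivAlternating δ₁ D₁ hD₁ (derivAlternating δ₂ D₂ hD₂ w) -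
        derivAlternating δ₂ D₂ hD₂ (derivAlternating δ₁ D₁ hD₁ w) := by
  ext Y
  have inner : ∀ (D D' : G →ₗ[ℝ] G) (i : ι),
      ∑ j, w (Function.update (Function.update Y i (D (Y i))) j
        (D' (Function.update Y i (D (Y i)) j))) =
      w (Function.update Y i (D' (D (Y i)))) + ∑ j ∈ Finset.univ.erase i,
        w (Function.update (Function.update Y i (D (Y i))) j (D' (Y j))) := by
    intro D D' i
    rw [← Finset.add_sum_erase _ _ (Finset.mem_univ i), Function.update_self,
      Function.update_idem]
    congr 1
    refine Finset.sum_congr rfl fun j hj => ?_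
    rw [Function.update_of_ne (Finset.ne_of_mem_erase hj)]
  have symm : ∑ i, ∑ j ∈ Finset.univ.erase i,
      w (Function.update (Function.update Y i (D₁ (Y i))) j (D₂ (Y j))) =
      ∑ i, ∑ j ∈ Finset.univ.erase i,
      w (Function.update (Function.update Y i (D₂ (Y i))) j (D₁ (Y j))) := by
    rw [Finset.sum_comm' (t' := Finset.univ) (s' := fun i => Finset.univ.erase i)
      (by simp [ne_comm])]
    refine Finset.sum_congr rfl fun i _ => Finset.sum_congr rfl fun j hj => ?_
    rw [Function.update_comm (Finset.ne_of_mem_erase hj)]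
  simp only [derivAlternating_apply, AlternatingMap.sub_apply, map_sub, map_sum,
    Finset.sum_sub_distrib, inner, Finset.sum_add_distrib, symm, hδ, hDD, w.map_update_sub]
  ring

end Derivations

/-! ### Local frames and alternating maps of top degree -/

section Frames

variable {E : Type*} [NormedAddCommGroup E] [NormedSpace ℝ E]
  {M : Type*} [TopologicalSpace M] [ChartedSpace E M]
  {P : Type*} [AddCommGroup P] [Module (Smooth E M) P]
  {ι : Type*}

theorem Smooth.add_apply (f g : Smooth E M) (x : M) : (f + g) x = f x + g x := rfl

theorem Smooth.sub_apply (f g : Smooth E M) (x : M) : (f - g) x = f x - g x := rfl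

theorem Smooth.mul_apply (f g : Smooth E M) (x : M) : (f * g) x = f x * g x := rfl

theorem Smooth.sum_apply {κ : Type*} (t : Finset κ) (f : κ → Smooth E M) (x : M) :
    (∑ i ∈ t, f i) x = ∑ i ∈ t, f i x :=
  map_sum (ContMDiffMap.evalRingHom x : Smooth E M →+* ℝ) f t

theorem Smooth.prod_apply {κ : Type*} (t : Finset κ) (f : κ → Smooth E M) (x : M) :
    (∏ i ∈ t, f i) x = ∏ i ∈ t, f i x :=
  map_prod (ContMDiffMap.evalRingHom x : Smooth E M →+* ℝ) f t

theorem smul_injective_of_nonVanishing {η : P [⋀^ι]→ₗ[Smooth E M] Smooth E M}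
    (hη : ∀ x, ∃ Y, η Y x ≠ 0) {f g : Smooth E M} (h : f • η = g • η) : f = g := by
  ext x
  obtain ⟨Y, hY⟩ := hη x
  have := congrArg (fun τ : P [⋀^ι]→ₗ[Smooth E M] Smooth E M => τ Y x) h
  simp only [AlternatingMap.smul_apply, smul_eq_mul, Smooth.mul_apply] at this
  exact mul_right_cancel₀ hY this

variable [Fintype ι]

variable (E P ι) in
/-- A frame of the `C^∞(M)`-module `P` around the point `x`: global elements `elt i` and
coordinate functions `coord i` which decompose `cutoff • p` for every `p`. -/
structure FrameAt (x : M) where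
  /-- a function with value one at `x` -/
  cutoff : Smooth E M
  cutoff_apply : cutoff x = 1
  /-- the elements of the frame -/
  elt : ι → P
  /-- the coordinate functions of the frame -/
  coord : ι → P →ₗ[Smooth E M] Smooth E M
  cutoff_smul : ∀ p, cutoff • p = ∑ i, coord i p • elt i

/-- The dual frame of the dual module. -/
def FrameAt.dual {x : M} (B : FrameAt E P ι x) : FrameAt E (P →ₗ[Smooth E M] Smooth E M) ι x where
  cutoff := B.cutoff
  cutoff_apply := B.cutoff_apply
  elt := B.coord
  coord i := LinearMap.applyₗ (B.elt i)
  cutoff_smul α := by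
    ext p : 1
    have h := congrArg α (B.cutoff_smul p)
    simp only [map_smul, map_sum, smul_eq_mul] at h
    simp only [LinearMap.smul_apply, LinearMap.sum_apply, LinearMap.applyₗ_apply_apply,
      smul_eq_mul, h, mul_comm]

theorem FrameAt.linearMap_apply {x : M} (B : FrameAt E P ι x)
    (L : P →ₗ[Smooth E M] Smooth E M) (p : P) :
    L p x = ∑ i, B.coord i p x * L (B.elt i) x := by
  have h := congrArg (fun f : Smooth E M => f x) (congrArg L (B.cutoff_smul p))
  simp only [map_smul, map_sum, smul_eq_mul, Smooth.mul_apply, B.cutoff_apply, one_mul,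
    Smooth.sum_apply] at h
  exact h

variable [DecidableEq ι]

/-- Multiplying every slot by the cutoff leaves the value at `x` unchanged and allows expansion in
the frame. Each term is indexed by a map `r : ι → ι`: an injective `r` is a permutation and gives
`±w B.elt`, any other repeats an argument and gives zero. -/
theorem FrameAt.apply_eq_zero {x : M} (B : FrameAt E P ι x)
    (w : P [⋀^ι]→ₗ[Smooth E M] Smooth E M) (hw : w B.elt x = 0) (Y : ι → P) : w Y x = 0 := by
  have h1 : w Y x = w (fun i => B.cutoff • Y i) x := by
    have h := congrArg (fun f : Smooth E M => f x)
      (w.toMultilinearMap.map_smul_univ (fun _ => B.cutoff) Y)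
    simp only [smul_eq_mul, Smooth.mul_apply, Smooth.prod_apply, B.cutoff_apply,
      Finset.prod_const_one, one_mul] at h
    exact h.symm
  have h2 : w (fun i => B.cutoff • Y i) =
      ∑ r : ι → ι, (∏ i, B.coord (r i) (Y i)) • w (fun i => B.elt (r i)) := by
    simp only [B.cutoff_smul]
    refine (w.toMultilinearMap.map_sum (fun i j => B.coord j (Y i) • B.elt j)).trans ?_
    exact Finset.sum_congr rfl fun r _ =>
      w.toMultilinearMap.map_smul_univ (fun i => B.coord (r i) (Y i)) (fun i => B.elt (r i))
  rw [h1, h2, Smooth.sum_apply]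
  refine Finset.sum_eq_zero fun r _ => ?_
  by_cases hr : Function.Injective r
  · have hp := w.map_perm B.elt (Equiv.ofBijective r (Finite.injective_iff_bijective.1 hr))
    have hp' : w (fun i => B.elt (r i)) x = 0 := by
      have : (fun i => B.elt (r i)) =
        B.elt ∘ (Equiv.ofBijective r (Finite.injective_iff_bijective.1 hr)) := rfl
      rw [this, hp]
      rcases Int.units_eq_one_or
        (Equiv.Perm.sign (Equiv.ofBijective r (Finite.injective_iff_bijective.1 hr))) with h | h
      · simpa [h] using hw
      · simpa [h] using hw
    simp [hp']
  · have : w (fun i => B.elt (r i)) = 0 := by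
      simp only [Function.Injective, not_forall] at hr
      obtain ⟨i, j, hij, hne⟩ := hr
      exact w.map_eq_zero_of_eq _ (congrArg B.elt hij) hne
    simp [this]

/-- A derivation over the zero derivation acts on forms of top degree by minus its trace. -/
theorem FrameAt.derivAlternating_zero_apply [Module ℝ P] {x : M} (B : FrameAt E P ι x)
    (D : P →ₗ[ℝ] P)
    (hD : ∀ (f : Smooth E M) (s : P),
      D (f • s) = f • D s + (0 : Derivation ℝ (Smooth E M) (Smooth E M)) f • s)
    (w : P [⋀^ι]→ₗ[Smooth E M] Smooth E M) (Y : ι → P) :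
    derivAlternating 0 D hD w Y x = -(∑ i, B.coord i (D (B.elt i)) x) * w Y x := by
  -- Over the zero derivation the sum of `derivAlternating 0 D hD w` and trace times `w` is an
  -- alternating form, so its vanishing at `x` needs checking only on the frame.
  have key := B.apply_eq_zero
    (derivAlternating 0 D hD w + (∑ i, B.coord i (D (B.elt i))) • w) ?_ Y
  · simp only [AlternatingMap.add_apply, AlternatingMap.smul_apply, smul_eq_mul,
      Smooth.add_apply, Smooth.mul_apply, Smooth.sum_apply] at key
    linarith
  · have h : ∀ i, w (Function.update B.elt i (D (B.elt i))) x =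
        B.coord i (D (B.elt i)) x * w B.elt x := by
      intro i
      -- In slot `i` only the `i`-th component of `D (B.elt i)` counts: any other repeats a frame
      -- element.
      have h1 := B.linearMap_apply (w.toMultilinearMap.toLinearMap B.elt i) (D (B.elt i))
      refine h1.trans ?_
      rw [Finset.sum_eq_single i]
      · congr 2
        exact congrArg w (Function.update_eq_self i B.elt)
      · intro j _ hj
        have : w (Function.update B.elt i (B.elt j)) = 0 :=
          w.map_update_self _ hj.symm
        change _ * (w (Function.update B.elt i (B.elt j))) x = 0
        simp [this]
      · simp
    simp only [AlternatingMap.add_apply, AlternatingMap.smul_apply, smul_eq_mul,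
      Smooth.add_apply, Smooth.mul_apply, Smooth.sum_apply, derivAlternating_apply,
      Smooth.sub_apply, h, Finset.sum_mul, Derivation.zero_apply]
    simp

/-- Every alternating map of top degree is a multiple of a non-vanishing one. -/
theorem exists_eq_smul_of_nonVanishing (hB : ∀ x : M, Nonempty (FrameAt E P ι x))
    (η : P [⋀^ι]→ₗ[Smooth E M] Smooth E M) (hη : ∀ x, ∃ Y, η Y x ≠ 0)
    (τ : P [⋀^ι]→ₗ[Smooth E M] Smooth E M) : ∃ f : Smooth E M, τ = f • η := by
  choose Y hY using hη
  -- Proportionality at each point: the combination `τ B.elt • η - η B.elt • τ` vanishes on the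
  -- frame, hence on every tuple at `x`.
  have comm : ∀ (x : M) (Z Z' : ι → P), τ Z x * η Z' x = τ Z' x * η Z x := by
    intro x Z Z'
    obtain ⟨B⟩ := hB x
    have h := B.apply_eq_zero (τ B.elt • η - η B.elt • τ) (by simp [mul_comm])
    simp only [AlternatingMap.sub_apply, AlternatingMap.smul_apply, smul_eq_mul,
      Smooth.sub_apply, Smooth.mul_apply] at h
    have h0 : η B.elt x ≠ 0 := fun h0 => hY x (B.apply_eq_zero η h0 _)
    apply mul_left_cancel₀ h0
    linear_combination η Z x * h Z' - η Z' x * h Z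
  refine ⟨⟨fun x => τ (Y x) x / η (Y x) x, fun x => ?_⟩, ?_⟩
  -- The tuple `Y y` need not vary continuously with `y`, but by `comm` the quotient is independent
  -- of the tuple, so near `x` it may be computed with the fixed tuple `Y x`.
  · have h1 : ContMDiffAt 𝓘(ℝ, E) 𝓘(ℝ, ℝ) ∞ (fun y => τ (Y x) y / η (Y x) y) x :=
      (τ (Y x)).contMDiff.contMDiffAt.div₀ (η (Y x)).contMDiff.contMDiffAt (hY x)
    refine h1.congr_of_eventuallyEq ?_
    filter_upwards [(η (Y x)).contMDiff.continuous.continuousAt.eventually_ne (hY x)] with y hy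
    rw [div_eq_div_iff (hY y) hy]
    exact comm y _ _
  · ext Z x
    change τ Z x = τ (Y x) x / η (Y x) x * η Z x
    rw [div_mul_eq_mul_div, eq_div_iff (hY x)]
    exact comm x Z (Y x)

end Frames

/-! ### Frames of vector bundles, and the Lie algebra of vector fields -/

section Bundles

variable {E : Type*} [NormedAddCommGroup E] [NormedSpace ℝ E]
  {M : Type*} [TopologicalSpace M] [ChartedSpace E M] [IsManifold 𝓘(ℝ, E) ∞ M]
  {F : Type*} [NormedAddCommGroup F] [NormedSpace ℝ F]
  {V : M → Type*} [TopologicalSpace (TotalSpace F V)] [∀ x, AddCommGroup (V x)]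
  [∀ x, Module ℝ (V x)] [∀ x, TopologicalSpace (V x)] [FiberBundle F V] [VectorBundle ℝ F V]

omit [IsManifold 𝓘(ℝ, E) ∞ M] in
theorem Sec.sum_apply {κ : Type*} (t : Finset κ) (s : κ → Sec E F V) (x : M) :
    (∑ i ∈ t, s i) x = ∑ i ∈ t, s i x :=
  map_sum (⟨⟨fun s => s x, rfl⟩, fun _ _ => rfl⟩ : Sec E F V →+ V x) s t

/-- A vector bundle has, around every point, a frame of global sections which restricts to a basis
of the fibre at that point. -/
theorem Sec.exists_frameAt [FiniteDimensional ℝ E] [T2Space M] [FiniteDimensional ℝ F]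
    [ContMDiffVectorBundle ∞ F V 𝓘(ℝ, E)] (x : M) :
    ∃ (B : FrameAt E (Sec E F V) (Fin (finrank ℝ F)) x) (b : Basis (Fin (finrank ℝ F)) ℝ (V x)),
      (∀ i, B.elt i x = b i) ∧ ∀ i X, B.coord i X x = b.repr (X x) i := by
  let e := trivializationAt F V x
  let b := Module.finBasis ℝ F
  have hx : x ∈ e.baseSet := FiberBundle.mem_baseSet_trivializationAt' x
  obtain ⟨χ, hχ⟩ := (SmoothBumpFunction.nhds_basis_support (I := 𝓘(ℝ, E))
    (e.open_baseSet.mem_nhds hx)).ex_mem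
  have hzero : ∀ y ∉ e.baseSet, χ y = 0 := fun y hy =>
    image_eq_zero_of_notMem_tsupport fun h => hy (hχ h)
  let χ' : Smooth E M := ⟨χ, χ.contMDiff⟩
  let elt : Fin (finrank ℝ F) → Sec E F V := fun i => ⟨fun y => χ y • e.localFrame b i y,
    ContMDiffOn.smul_section_of_tsupport χ.contMDiff.contMDiffOn e.open_baseSet hχ
      (e.contMDiffOn_localFrame_baseSet ∞ b i)⟩
  let coord : Fin (finrank ℝ F) → Sec E F V →ₗ[Smooth E M] Smooth E M := fun i =>
    { toFun := fun X => ⟨fun y => χ y • e.localFrameCoeff 𝓘(ℝ, E) b i y (X y), by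
        refine contMDiff_of_tsupport fun y hy => ?_
        have hy' : y ∈ e.baseSet := hχ (closure_mono (Function.support_smul_subset_left _ _) hy)
        exact χ.contMDiff.contMDiffAt.smul
          (contMDiffAt_localFrameCoeff b hy' X.contMDiff.contMDiffAt i)⟩
      map_add' := fun X Y => by
        ext y
        exact (congrArg (χ y • ·) (map_add (e.localFrameCoeff 𝓘(ℝ, E) b i y) (X y) (Y y))).trans
          (smul_add _ _ _)
      map_smul' := fun f X => by
        ext y
        change χ y • e.localFrameCoeff 𝓘(ℝ, E) b i y (f y • X y) = f y • (χ y • _)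
        rw [map_smul, smul_comm] }
  -- The cutoff is a square because frame elements and coordinates each carry one factor of the bump
  -- function.
  refine ⟨⟨χ' * χ', ?_, elt, coord, ?_⟩, e.basisAt b hx, ?_, ?_⟩
  · change χ x * χ x = 1
    rw [χ.eq_one, one_mul]
  · intro X
    ext y
    rw [Sec.sum_apply]
    change (χ y * χ y) • X y =
      ∑ i, (χ y • e.localFrameCoeff 𝓘(ℝ, E) b i y (X y)) • (χ y • e.localFrame b i y)
    by_cases hy : y ∈ e.baseSet
    · conv_lhs => rw [e.eq_sum_localFrameCoeff_smul (I := 𝓘(ℝ, E)) (b := b) (s := X) hy]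
      rw [Finset.smul_sum]
      refine Finset.sum_congr rfl fun i _ => ?_
      simp only [smul_smul, smul_eq_mul]
      congr 1
      ring
    · simp [hzero y hy]
  · intro i
    change χ x • e.localFrame b i x = _
    rw [χ.eq_one, one_smul, e.localFrame_apply_of_mem_baseSet b hx]
  · intro i X
    change χ x • e.localFrameCoeff 𝓘(ℝ, E) b i x (X x) = _
    rw [χ.eq_one, one_smul, e.localFrameCoeff_apply_of_mem_baseSet b hx X]

theorem Sec.nonempty_frameAt [FiniteDimensional ℝ E] [T2Space M] [FiniteDimensional ℝ F]
    [ContMDiffVectorBundle ∞ F V 𝓘(ℝ, E)] (x : M) :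
    Nonempty (FrameAt E (Sec E F V) (Fin (finrank ℝ F)) x) :=
  ⟨(Sec.exists_frameAt x).choose⟩

variable (E F V) in
theorem OneForm.nonempty_frameAt [FiniteDimensional ℝ E] [T2Space M] [FiniteDimensional ℝ F]
    [ContMDiffVectorBundle ∞ F V 𝓘(ℝ, E)] (x : M) :
    Nonempty (FrameAt E (OneForm E F V) (Fin (finrank ℝ F)) x) :=
  ⟨(Sec.exists_frameAt x).choose.dual⟩

variable (E M) in
theorem contMDiffVectorBundle_tangentSpace :
    ContMDiffVectorBundle ∞ E (TangentSpace 𝓘(ℝ, E) : M → Type _) 𝓘(ℝ, E) := by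
  have : IsManifold 𝓘(ℝ, E) (((⊤ : ℕ∞) : WithTop ℕ∞) + 1) M := by
    simpa using (inferInstance : IsManifold 𝓘(ℝ, E) ∞ M)
  exact TangentBundle.contMDiffVectorBundle

theorem VField.nonempty_frameAt [FiniteDimensional ℝ E] [T2Space M] (x : M) :
    Nonempty (FrameAt E (VField E M) (Fin (finrank ℝ E)) x) :=
  have := contMDiffVectorBundle_tangentSpace E M
  Sec.nonempty_frameAt x

omit [IsManifold 𝓘(ℝ, E) ∞ M] in
theorem Smooth.ne_zero_of_smul_nonVanishing {P ι : Type*} [AddCommGroup P] [Module (Smooth E M) P]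
    {η : P [⋀^ι]→ₗ[Smooth E M] Smooth E M} {f : Smooth E M} (h : ∀ x, ∃ Y, (f • η) Y x ≠ 0)
    (x : M) : f x ≠ 0 := by
  obtain ⟨Y, hY⟩ := h x
  exact left_ne_zero_of_mul (b := η Y x) hY

/-- The function `log |f|` of a nowhere zero function `f`. -/
def Smooth.log (f : Smooth E M) (hf : ∀ x, f x ≠ 0) : Smooth E M :=
  ⟨fun x => Real.log (f x), fun x =>
    ((Real.contDiffAt_log (n := ∞)).2 (hf x)).contMDiffAt.comp x f.contMDiff.contMDiffAt⟩

theorem VField.mul_act_log (Z : VField E M) (f : Smooth E M) (hf : ∀ x, f x ≠ 0) :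
    f * Z.act (f.log hf) = Z.act f := by
  ext x
  have h1 := (Real.hasDerivAt_log (hf x)).hasFDerivAt.hasMFDerivAt
  have h2 := (f.contMDiff.mdifferentiable (by simp) x).hasMFDerivAt
  have h3 := (h1.comp x h2).mfderiv
  have h4 : Z.act (f.log hf) x = Z.act f x * (f x)⁻¹ := congrArg (fun L => L (Z x)) h3
  rw [Smooth.mul_apply, h4, mul_left_comm, mul_inv_cancel₀ (hf x), mul_one]

variable [CompleteSpace E]

theorem VField.bracket_jacobi (Z Z' Z'' : VField E M) :
    (Z.bracket Z').bracket Z'' = Z.bracket (Z'.bracket Z'') - Z'.bracket (Z.bracket Z'') := by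
  have : IsManifold 𝓘(ℝ, E) (minSmoothness ℝ 3) M := by
    simpa using (inferInstance : IsManifold 𝓘(ℝ, E) 3 M)
  have hc : ∀ Z : VField E M, ContMDiff 𝓘(ℝ, E) 𝓘(ℝ, E).tangent (minSmoothness ℝ 2)
      (fun x => (⟨x, Z x⟩ : TangentBundle 𝓘(ℝ, E) M)) := fun Z =>
    Z.contMDiff.of_le (by
      simpa using (WithTop.coe_le_coe.2 le_top : ((2 : ℕ∞) : WithTop ℕ∞) ≤ ∞))
  ext x
  have h := VectorField.leibniz_identity_mlieBracket_apply (hc Z x) (hc Z' x) (hc Z'' x)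
  exact eq_sub_of_add_eq h.symm

theorem VField.bracket_swap (Z Z' : VField E M) : Z.bracket Z' = -Z'.bracket Z := by
  ext x
  exact VectorField.mlieBracket_swap_apply

theorem VField.smul_bracket (f : Smooth E M) (Z Z' : VField E M) :
    (f • Z).bracket Z' = f • Z.bracket Z' - Z'.act f • Z := by
  rw [VField.bracket_swap, VField.bracket_smul, VField.bracket_swap Z' Z, smul_neg]
  abel

/-- Expanding the Jacobi identity for `Z`, `Z'`, `f • W` by the Leibniz rule leaves the claim
multiplied by `W`; a frame element that is non-zero at `x` serves as `W`. -/
theorem VField.bracket_act [FiniteDimensional ℝ E] [T2Space M] (Z Z' : VField E M)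
    (f : Smooth E M) : (Z.bracket Z').act f = Z.act (Z'.act f) - Z'.act (Z.act f) := by
  have key : ∀ W : VField E M,
      (Z.bracket Z').act f • W = (Z.act (Z'.act f) - Z'.act (Z.act f)) • W := by
    intro W
    have h := VField.bracket_jacobi Z Z' (f • W)
    simp only [VField.bracket_smul, map_add, VField.bracket_jacobi Z Z' W, smul_sub] at h
    rw [sub_smul]
    have h' := sub_eq_zero.2 h
    rw [← sub_eq_zero, ← h']
    abel
  have := contMDiffVectorBundle_tangentSpace E M
  ext x
  obtain ⟨B, b, hb, -⟩ := Sec.exists_frameAt (E := E) (F := E)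
    (V := (TangentSpace 𝓘(ℝ, E) : M → Type _)) x
  -- In dimension zero no such `W` exists, but all derivatives vanish.
  rcases isEmpty_or_nonempty (Fin (finrank ℝ E)) with h | ⟨⟨i⟩⟩
  · have : Subsingleton (TangentSpace 𝓘(ℝ, E) x) := b.repr.toEquiv.subsingleton
    have h0 : ∀ (Z : VField E M) (g : Smooth E M), Z.act g x = 0 := fun Z g => by
      rw [VField.act_apply, Subsingleton.elim (Z x) 0, map_zero]
      rfl
    rw [Smooth.sub_apply, h0, h0, h0, sub_zero]
  · have h := congrArg (fun W : VField E M => W x) (key (B.elt i))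
    simp only [Sec.smul_apply, hb] at h
    exact smul_left_injective ℝ (b.ne_zero i) h

end Bundles

section Modular

variable {E : Type*} [NormedAddCommGroup E] [NormedSpace ℝ E] [CompleteSpace E]
  {M : Type*} [TopologicalSpace M] [ChartedSpace E M] [IsManifold 𝓘(ℝ, E) ∞ M]
  {F : Type*} [NormedAddCommGroup F] [NormedSpace ℝ F]
  {V : M → Type*} [TopologicalSpace (TotalSpace F V)] [∀ x, AddCommGroup (V x)]
  [∀ x, Module ℝ (V x)] [∀ x, TopologicalSpace (V x)] [FiberBundle F V] [VectorBundle ℝ F V]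

/-! ### Lie derivatives of forms of top degree on the base -/

theorem lieTopForm_smul_right (Z : VField E M) (f : Smooth E M) (μ : TopForm E M) :
    lieTopForm Z (f • μ) = f • lieTopForm Z μ + Z.act f • μ :=
  derivAlternating_smul _ _ _ f μ

theorem lieTopForm_add_left (Z Z' : VField E M) (μ : TopForm E M) :
    lieTopForm (Z + Z') μ = lieTopForm Z μ + lieTopForm Z' μ := by
  have h := derivAlternating_smul_add (1 : Smooth E M) (hD := (Z + Z').bracket_smul)
    (hD₁ := Z.bracket_smul) (hD₂ := Z'.bracket_smul)
    (fun f => by rw [VField.add_act, one_mul])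
    (fun W => by
      rw [VField.bracket_swap, map_add, VField.bracket_swap Z, VField.bracket_swap Z', one_smul,
        neg_add]) μ
  rwa [one_smul] at h

/-- The correction in `[fZ, W] = f[Z, W] - (W·f)Z` is tensorial in `W` with trace `-Z·f`, and it
acts on top forms by minus that trace. -/
theorem lieTopForm_smul_left [FiniteDimensional ℝ E] [T2Space M] (f : Smooth E M)
    (Z : VField E M) (μ : TopForm E M) :
    lieTopForm (f • Z) μ = f • lieTopForm Z μ + Z.act f • μ := by
  let T : VField E M →ₗ[ℝ] VField E M :=
    { toFun := fun W => -(W.act f • Z)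
      map_add' := fun W W' => by rw [VField.add_act, add_smul, neg_add]
      map_smul' := fun c W => by
        ext x
        have h : (c • W).act f x = c * W.act f x :=
          map_smul (mfderiv 𝓘(ℝ, E) 𝓘(ℝ, ℝ) f x) c (W x)
        change -((c • W).act f x • Z x) = c • -(W.act f x • Z x)
        rw [h, smul_neg, smul_smul] }
  have hT : ∀ (g : Smooth E M) (W : VField E M),
      T (g • W) = g • T W + (0 : Derivation ℝ (Smooth E M) (Smooth E M)) g • W := fun g W => by
    change -((g • W).act f • Z) = g • -(W.act f • Z) + (0 : Smooth E M) • W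
    rw [VField.smul_act, zero_smul, add_zero, smul_neg, smul_smul]
  have h := derivAlternating_smul_add f (hD := (f • Z).bracket_smul)
    (hD₁ := Z.bracket_smul) (hD₂ := hT)
    (fun g => by rw [VField.smul_act, Derivation.zero_apply, add_zero])
    (fun W => by rw [VField.smul_bracket, sub_eq_add_neg]; rfl) μ
  refine h.trans (congrArg (f • lieTopForm Z μ + ·) ?_)
  ext Y x
  obtain ⟨B⟩ := VField.nonempty_frameAt (E := E) x
  rw [B.derivAlternating_zero_apply T hT μ Y, AlternatingMap.smul_apply, smul_eq_mul,
    Smooth.mul_apply]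
  congr 1
  let d : VField E M →ₗ[Smooth E M] Smooth E M :=
    { toFun := fun W => W.act f
      map_add' := fun W W' => VField.add_act W W' f
      map_smul' := fun g W => VField.smul_act g W f }
  have hd := B.linearMap_apply d Z
  change Z.act f x = ∑ i, B.coord i Z x * (B.elt i).act f x at hd
  rw [hd, ← Finset.sum_neg_distrib]
  refine Finset.sum_congr rfl fun i _ => ?_
  change -(B.coord i (-((B.elt i).act f • Z)) x) = _
  rw [map_neg, map_smul]
  change -(-((B.elt i).act f x * B.coord i Z x)) = _
  rw [neg_neg, mul_comm]

theorem lieTopForm_bracket [FiniteDimensional ℝ E] [T2Space M] (Z Z' : VField E M)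
    (μ : TopForm E M) :
    lieTopForm (Z.bracket Z') μ =
      lieTopForm Z (lieTopForm Z' μ) - lieTopForm Z' (lieTopForm Z μ) :=
  derivAlternating_commutator (VField.bracket_act Z Z') (VField.bracket_jacobi Z Z') μ

namespace LieAlgebroid

variable (A : LieAlgebroid E F V)

/-! ### Lie derivatives of multivector fields of top degree -/

theorem rho_bracket (X Y : Sec E F V) : A.rho (A.bracket X Y) = (A.rho X).bracket (A.rho Y) :=
  A.anchor_bracket X Y

theorem dZero_apply (f : Smooth E M) (X : Sec E F V) :
    A.dZero f X = (A.rho X).act f := rfl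

theorem lieTop_smul_right (X : Sec E F V) (f : Smooth E M) (η : TopMultivector E F V) :
    A.lieTop X (f • η) = f • A.lieTop X η + (A.rho X).act f • η :=
  derivAlternating_smul _ _ _ f η

theorem lieTop_add_left (X Y : Sec E F V) (η : TopMultivector E F V) :
    A.lieTop (X + Y) η = A.lieTop X η + A.lieTop Y η := by
  have h := derivAlternating_smul_add (1 : Smooth E M) (hD := A.lieOneForm_smul (X + Y))
    (hD₁ := A.lieOneForm_smul X) (hD₂ := A.lieOneForm_smul Y)
    (fun f => by rw [map_add, VField.add_act, one_mul])
    (fun α => by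
      ext Z : 1
      simp only [lieOneForm_apply, map_add, VField.add_act, LinearMap.add_apply, one_smul]
      abel) η
  rwa [one_smul] at h

/-- Here the correction is `α ↦ α(X) d_A f`, with trace `ρ(X)·f`, so the sign is opposite to that in
`lieTopForm_smul_left`. -/
theorem lieTop_smul_left [FiniteDimensional ℝ E] [T2Space M] [FiniteDimensional ℝ F]
    [ContMDiffVectorBundle ∞ F V 𝓘(ℝ, E)] (f : Smooth E M) (X : Sec E F V)
    (η : TopMultivector E F V) :
    A.lieTop (f • X) η = f • A.lieTop X η - (A.rho X).act f • η := by
  let T : OneForm E F V →ₗ[ℝ] OneForm E F V :=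
    { toFun := fun α => α X • A.dZero f
      map_add' := fun α β => add_smul (α X) (β X) (A.dZero f)
      map_smul' := fun c α => smul_assoc c (α X) (A.dZero f) }
  have hT : ∀ (g : Smooth E M) (α : OneForm E F V),
      T (g • α) = g • T α + (0 : Derivation ℝ (Smooth E M) (Smooth E M)) g • α := fun g α => by
    change (g * α X) • A.dZero f = g • (α X • A.dZero f) + (0 : Smooth E M) • α
    rw [zero_smul, add_zero, smul_smul]
  have h := derivAlternating_smul_add f (hD := A.lieOneForm_smul (f • X))
    (hD₁ := A.lieOneForm_smul X) (hD₂ := hT)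
    (fun g => by rw [map_smul, VField.smul_act, Derivation.zero_apply, add_zero])
    (fun α => by
      ext Y : 1
      change (A.rho (f • X)).act (α Y) - α (A.bracket (f • X) Y) =
        f * ((A.rho X).act (α Y) - α (A.bracket X Y)) + α X * (A.rho Y).act f
      rw [map_smul, VField.smul_act, A.smul_bracket, map_sub, map_smul, map_smul, smul_eq_mul,
        smul_eq_mul]
      ring) η
  rw [sub_eq_add_neg]
  refine h.trans (congrArg (f • A.lieTop X η + ·) ?_)
  ext Y x
  obtain ⟨B, -⟩ := Sec.exists_frameAt (E := E) (F := F) (V := V) x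
  rw [B.dual.derivAlternating_zero_apply T hT η Y]
  change _ = -((A.rho X).act f x * η Y x)
  rw [neg_mul, ← A.dZero_apply, B.linearMap_apply (A.dZero f) X]
  rfl

theorem lieTop_bracket [FiniteDimensional ℝ E] [T2Space M] (X Y : Sec E F V)
    (η : TopMultivector E F V) :
    A.lieTop (A.bracket X Y) η = A.lieTop X (A.lieTop Y η) - A.lieTop Y (A.lieTop X η) :=
  derivAlternating_commutator
    (fun f => by rw [A.rho_bracket, VField.bracket_act])
    (fun α => by
      ext Z : 1
      have h : A.bracket (A.bracket X Y) Z =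
          A.bracket X (A.bracket Y Z) - A.bracket Y (A.bracket X Z) :=
        eq_sub_of_add_eq (A.jacobi X Y Z).symm
      simp only [lieOneForm_apply, LinearMap.sub_apply, map_sub, A.rho_bracket,
        VField.bracket_act, h]
      abel) η

omit [CompleteSpace E] [IsManifold 𝓘(ℝ, E) ∞ M] in
-- The vacuous zero term puts linearity of `N*` into the form required by `derivAlternating`.
theorem pullback_smul (N : BundleMap E F V F V) (f : Smooth E M) (α : OneForm E F V) :
    N.pullback (f • α) =
      f • N.pullback α + (0 : Derivation ℝ (Smooth E M) (Smooth E M)) f • α := by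
  rw [Derivation.zero_apply, zero_smul, add_zero]
  rfl

/-! ### Existence, uniqueness and closedness of the modular form -/

omit [CompleteSpace E] in
-- Evaluation on `(α, Z)` descends to the tensor product and sends `η ⊗ μ` to a function non-zero at
-- `x`.
theorem smul_tmul_injective {η : TopMultivector E F V} {μ : TopForm E M} (hη : η.NonVanishing)
    (hμ : μ.NonVanishing) {f g : Smooth E M}
    (h : f • (η ⊗ₜ[Smooth E M] μ) = g • (η ⊗ₜ[Smooth E M] μ)) : f = g := by
  ext x
  obtain ⟨α, hα⟩ := hη x
  obtain ⟨Z, hZ⟩ := hμ x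
  let L : TopMultivector E F V ⊗[Smooth E M] TopForm E M →ₗ[Smooth E M] Smooth E M :=
    TensorProduct.lift (LinearMap.mk₂ (Smooth E M) (fun η μ => η α * μ Z)
      (fun η η' μ => add_mul _ _ _) (fun c η μ => mul_assoc _ _ _)
      (fun η μ μ' => mul_add _ _ _) (fun c η μ => mul_left_comm _ _ _))
  have hL := congrArg (fun k : Smooth E M => k x) (congrArg L h)
  simp only [map_smul] at hL
  exact mul_right_cancel₀ (mul_ne_zero hα hZ) hL

/-- This trades the tensor identity for a scalar one. The multipliers `a`, `b` are bare functions,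
since neither is `C^∞(M)`-linear by itself. -/
theorem isModularForm_iff {η : TopMultivector E F V} {μ : TopForm E M} (hη : η.NonVanishing)
    (hμ : μ.NonVanishing) {a b : Sec E F V → Smooth E M}
    (ha : ∀ X, A.lieTop X η = a X • η) (hb : ∀ X, lieTopForm (A.rho X) μ = b X • μ)
    (ξ : OneForm E F V) : A.IsModularForm η μ ξ ↔ ∀ X, ξ X = a X + b X := by
  refine forall_congr' fun X => ?_
  rw [ha, hb, TensorProduct.tmul_smul, ← TensorProduct.smul_tmul', ← add_smul]
  exact ⟨smul_tmul_injective hη hμ, fun h => by rw [h]⟩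

variable [FiniteDimensional ℝ E] [T2Space M] [FiniteDimensional ℝ F]
  [ContMDiffVectorBundle ∞ F V 𝓘(ℝ, E)]

theorem exists_lieTop_eq_smul {η : TopMultivector E F V} (hη : η.NonVanishing) :
    ∃ a : Sec E F V → Smooth E M, ∀ X, A.lieTop X η = a X • η :=
  Classical.skolem.1 fun X =>
    exists_eq_smul_of_nonVanishing (OneForm.nonempty_frameAt E F V) η hη (A.lieTop X η)

omit [FiniteDimensional ℝ F] [ContMDiffVectorBundle ∞ F V 𝓘(ℝ, E)] in
theorem exists_lieTopForm_rho_eq_smul {μ : TopForm E M} (hμ : μ.NonVanishing) :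
    ∃ b : Sec E F V → Smooth E M, ∀ X, lieTopForm (A.rho X) μ = b X • μ :=
  Classical.skolem.1 fun X =>
    exists_eq_smul_of_nonVanishing VField.nonempty_frameAt μ hμ (lieTopForm (A.rho X) μ)

/-- Given non-vanishing `η` and `μ`, there is exactly one modular form, and it is closed. -/
theorem exists_modularForm {η : TopMultivector E F V} {μ : TopForm E M} (hη : η.NonVanishing)
    (hμ : μ.NonVanishing) :
    ∃ ξ : A.closedForms, ∀ ζ : OneForm E F V, A.IsModularForm η μ ζ ↔ ζ = ξ := by
  obtain ⟨a, ha⟩ := A.exists_lieTop_eq_smul hη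
  obtain ⟨b, hb⟩ := A.exists_lieTopForm_rho_eq_smul hμ
  have a_inj : ∀ {f g : Smooth E M}, f • η = g • η → f = g :=
    smul_injective_of_nonVanishing hη
  have b_inj : ∀ {f g : Smooth E M}, f • μ = g • μ → f = g :=
    smul_injective_of_nonVanishing hμ
  have a_add : ∀ X Y, a (X + Y) = a X + a Y := fun X Y => a_inj (by
    rw [add_smul, ← ha, ← ha, ← ha, lieTop_add_left])
  have b_add : ∀ X Y, b (X + Y) = b X + b Y := fun X Y => b_inj (by
    rw [add_smul, ← hb, ← hb, ← hb, map_add, lieTopForm_add_left])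
  have a_smul : ∀ f X, a (f • X) = f * a X - (A.rho X).act f := fun f X => a_inj (by
    rw [sub_smul, mul_smul, ← ha, ← ha, lieTop_smul_left])
  have b_smul : ∀ f X, b (f • X) = f * b X + (A.rho X).act f := fun f X => b_inj (by
    rw [add_smul, mul_smul, ← hb, ← hb, map_smul, lieTopForm_smul_left])
  -- In the commutator of Lie derivatives the products `a X * a Y` cancel, leaving a cocycle
  -- identity.
  have a_bracket : ∀ X Y, a (A.bracket X Y) = (A.rho X).act (a Y) - (A.rho Y).act (a X) :=
    fun X Y => a_inj (by
      rw [← ha, lieTop_bracket, ha, ha, lieTop_smul_right, lieTop_smul_right, ha, ha, sub_smul,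
        smul_smul, smul_smul, mul_comm (a X)]
      abel)
  have b_bracket : ∀ X Y, b (A.bracket X Y) = (A.rho X).act (b Y) - (A.rho Y).act (b X) :=
    fun X Y => b_inj (by
      rw [← hb, rho_bracket, lieTopForm_bracket, hb, hb, lieTopForm_smul_right,
        lieTopForm_smul_right, hb, hb, sub_smul, smul_smul, smul_smul, mul_comm (b X)]
      abel)
  let ξ : OneForm E F V :=
    { toFun := fun X => a X + b X
      map_add' := fun X Y => by
        rw [a_add, b_add]
        abel
      map_smul' := fun f X => by
        rw [a_smul, b_smul, RingHom.id_apply, smul_eq_mul]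
        ring }
  refine ⟨⟨ξ, ?_⟩, fun ζ => (A.isModularForm_iff hη hμ ha hb ζ).trans
    ⟨fun h => LinearMap.ext h, fun h X => by rw [h]; rfl⟩⟩
  change A.dOne ξ = 0
  refine LinearMap.ext fun X => LinearMap.ext fun Y => ?_
  change (A.rho X).act (a Y + b Y) - (A.rho Y).act (a X + b X) -
    (a (A.bracket X Y) + b (A.bracket X Y)) = 0
  rw [a_bracket, b_bracket, map_add, map_add]
  abel

/-- Modular forms with respect to different non-vanishing `η` and `μ` differ by an exact form. -/
theorem IsModularForm.sub_mem_exactForms {η η' : TopMultivector E F V} {μ μ' : TopForm E M}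
    {ξ ξ' : OneForm E F V} (hη : η.NonVanishing) (hμ : μ.NonVanishing) (hη' : η'.NonVanishing)
    (hμ' : μ'.NonVanishing) (h : A.IsModularForm η μ ξ) (h' : A.IsModularForm η' μ' ξ') :
    ξ' - ξ ∈ A.exactForms := by
  obtain ⟨a, ha⟩ := A.exists_lieTop_eq_smul hη
  obtain ⟨b, hb⟩ := A.exists_lieTopForm_rho_eq_smul hμ
  obtain ⟨f, rfl⟩ := exists_eq_smul_of_nonVanishing (OneForm.nonempty_frameAt E F V) η hη η'
  obtain ⟨g, rfl⟩ := exists_eq_smul_of_nonVanishing VField.nonempty_frameAt μ hμ μ'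
  have hf := Smooth.ne_zero_of_smul_nonVanishing hη'
  have hg := Smooth.ne_zero_of_smul_nonVanishing hμ'
  have ha' : ∀ X, A.lieTop X (f • η) = (a X + (A.rho X).act (f.log hf)) • (f • η) := fun X => by
    rw [lieTop_smul_right, ha, ← VField.mul_act_log _ f hf, smul_smul, smul_smul, ← add_smul]
    congr 1
    ring
  have hb' : ∀ X, lieTopForm (A.rho X) (g • μ) =
      (b X + (A.rho X).act (g.log hg)) • (g • μ) := fun X => by
    rw [lieTopForm_smul_right, hb, ← VField.mul_act_log _ g hg, smul_smul, smul_smul, ← add_smul]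
    congr 1
    ring
  rw [A.isModularForm_iff hη hμ ha hb] at h
  rw [A.isModularForm_iff hη' hμ' ha' hb'] at h'
  -- Each rescaling adds a logarithmic derivative to its multiplier, so the primitive is `log|f| +
  -- log|g|`.
  refine ⟨f.log hf + g.log hg, LinearMap.ext fun X => ?_⟩
  rw [LinearMap.sub_apply, h, h', dZero_apply, map_add]
  abel

/-- The pair `(η', μ')` behind the chosen class is unknown, but its modular form differs from `ξ` by
an exact form. -/
theorem modularClass_eq_cls {η : TopMultivector E F V} {μ : TopForm E M} (hη : η.NonVanishing)
    (hμ : μ.NonVanishing) {ξ : A.closedForms} (h : A.IsModularForm η μ ξ) :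
    A.modularClass = A.cls ξ := by
  have hex : ∃ c, A.IsModularClass c := ⟨A.cls ξ, η, μ, ξ, hη, hμ, h, rfl⟩
  rw [modularClass, dif_pos hex]
  obtain ⟨η', μ', ξ', hη', hμ', h', hc⟩ := hex.choose_spec
  rw [hc]
  exact (Submodule.Quotient.eq _).2
    (IsModularForm.sub_mem_exactForms A hη hμ hη' hμ' h h')

/-! ### The deformed algebroid of a Nijenhuis operator -/

omit [CompleteSpace E] in
-- In the dual frame the diagonal coefficients of `N*` at `x` are those of `N` in the fibre basis,
-- so the two traces agree; the minus sign comes from `derivAlternating`.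
theorem derivAlternating_pullback (N : BundleMap E F V F V) (η : TopMultivector E F V) :
    derivAlternating 0 N.pullback (pullback_smul N) η = -N.trace • η := by
  ext α x
  obtain ⟨B, b, hb, hB⟩ := Sec.exists_frameAt (E := E) (F := F) (V := V) x
  rw [B.dual.derivAlternating_zero_apply N.pullback (pullback_smul N) η α]
  change _ = -(LinearMap.trace ℝ (V x) (N.toFun x)) * η α x
  congr 2
  rw [LinearMap.trace_eq_matrix_trace ℝ b, Matrix.trace]
  refine Finset.sum_congr rfl fun i _ => ?_
  rw [Matrix.diag_apply, LinearMap.toMatrix_apply, ← hb i]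
  exact hB i (N.onSec (B.elt i))

/-- The Lie derivatives of the deformed algebroid on forms of top degree. -/
theorem lieTop_deform (N : BundleMap E F V F V) (hN : A.IsNijenhuis N) (X : Sec E F V)
    (η : TopMultivector E F V) :
    (A.deform N hN).lieTop X η = A.lieTop (N.onSec X) η + (A.rho X).act N.trace • η := by
  -- The commutator `[L_X, N*]` is tensorial: the derivatives along `ρ(X)` cancel.
  let K : OneForm E F V →ₗ[ℝ] OneForm E F V :=
    A.lieOneForm X ∘ₗ N.pullback - N.pullback ∘ₗ A.lieOneForm X
  have K_apply : ∀ α Y, K α Y = α (A.bracket X (N.onSec Y)) - α (N.onSec (A.bracket X Y)) := by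
    intro α Y
    change ((A.rho X).act (α (N.onSec Y)) - α (N.onSec (A.bracket X Y))) -
      ((A.rho X).act (α (N.onSec Y)) - α (A.bracket X (N.onSec Y))) = _
    abel
  have hK : ∀ (g : Smooth E M) (α : OneForm E F V),
      K (g • α) = g • K α + (0 : Derivation ℝ (Smooth E M) (Smooth E M)) g • α := fun g α => by
    ext Y : 1
    rw [Derivation.zero_apply, zero_smul, add_zero, LinearMap.smul_apply, K_apply, K_apply,
      LinearMap.smul_apply, LinearMap.smul_apply, smul_sub]
  have h1 : derivAlternating 0 K hK η = -((A.rho X).act N.trace • η) := by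
    have h := derivAlternating_commutator (hD := hK) (hD₁ := A.lieOneForm_smul X)
      (hD₂ := pullback_smul N) (fun f => by simp) (fun α => rfl) η
    rw [derivAlternating_pullback, derivAlternating_pullback, derivAlternating_smul,
      map_neg, neg_smul, neg_smul] at h
    rw [h]
    abel
  -- On one-forms `L_{NX} = L^N_X + K`, because `[X, Y]_N` differs from `[NX, Y]` by `[X, NY] - N[X,
  -- Y]`.
  have h2 := derivAlternating_smul_add (1 : Smooth E M)
    (hD := A.lieOneForm_smul (N.onSec X)) (hD₁ := (A.deform N hN).lieOneForm_smul X) (hD₂ := hK)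
    (fun f => by rw [one_mul, Derivation.zero_apply, add_zero]; rfl)
    (fun α => by
      ext Y : 1
      rw [one_smul, LinearMap.add_apply, K_apply]
      change _ = (A.rho (N.onSec X)).act (α Y) - α (A.deformedBracket N X Y) + _
      rw [deformedBracket_apply, lieOneForm_apply, map_sub, map_add]
      abel) η
  rw [one_smul, h1] at h2
  have h3 : A.lieTop (N.onSec X) η =
    (A.deform N hN).lieTop X η + -((A.rho X).act N.trace • η) := h2
  rw [h3]
  abel

/-- The anchor of `A_N` sends `X` to `ρ(NX)`, so the `μ`-multipliers cancel and only the trace term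
of `lieTop_deform` remains. -/
theorem IsModularForm.deform_sub_pullback {η : TopMultivector E F V} {μ : TopForm E M}
    (hη : η.NonVanishing) (hμ : μ.NonVanishing) {N : BundleMap E F V F V} (hN : A.IsNijenhuis N)
    {ξ ξN : OneForm E F V} (h : A.IsModularForm η μ ξ)
    (h' : (A.deform N hN).IsModularForm η μ ξN) : ξN - N.pullback ξ = A.dZero N.trace := by
  obtain ⟨a, ha⟩ := A.exists_lieTop_eq_smul hη
  obtain ⟨b, hb⟩ := A.exists_lieTopForm_rho_eq_smul hμ
  rw [A.isModularForm_iff hη hμ ha hb] at h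
  rw [(A.deform N hN).isModularForm_iff hη hμ
    (a := fun X => a (N.onSec X) + (A.rho X).act N.trace)
    (fun X => by rw [lieTop_deform, ha, add_smul]) (fun X => hb (N.onSec X))] at h'
  refine LinearMap.ext fun X => ?_
  change ξN X - ξ (N.onSec X) = (A.rho X).act N.trace
  rw [h, h']
  abel

end LieAlgebroid

end Modular

end ModularLieAlgebroid

end

theorem mainTheorem3
    {E : Type*} [NormedAddCommGroup E] [NormedSpace ℝ E] [FiniteDimensional ℝ E] [CompleteSpace E]
    {M : Type*} [TopologicalSpace M] [ChartedSpace E M] [IsManifold 𝓘(ℝ, E) ∞ M]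
    [T2Space M] [SigmaCompactSpace M]
    {F : Type*} [NormedAddCommGroup F] [NormedSpace ℝ F] [FiniteDimensional ℝ F]
    {V : M → Type*} [TopologicalSpace (TotalSpace F V)] [∀ x, AddCommGroup (V x)]
    [∀ x, Module ℝ (V x)] [∀ x, TopologicalSpace (V x)] [FiberBundle F V] [VectorBundle ℝ F V]
    [ContMDiffVectorBundle ∞ F V 𝓘(ℝ, E)]
    (A : ModularLieAlgebroid.LieAlgebroid E F V)
    (hA : ∃ η : ModularLieAlgebroid.TopMultivector E F V, η.NonVanishing)
    (hM : ∃ μ : ModularLieAlgebroid.TopForm E M, μ.NonVanishing)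
    (N : ModularLieAlgebroid.BundleMap E F V F V) (hN : A.IsNijenhuis N) :
    (∃ h : A.dZero N.trace ∈ (A.deform N hN).closedForms,
      (A.deformHom N hN).relativeModularClass =
        (A.deform N hN).cls ⟨A.dZero N.trace, h⟩) ∧
    (∀ (η : ModularLieAlgebroid.TopMultivector E F V) (μ : ModularLieAlgebroid.TopForm E M),
      η.NonVanishing → μ.NonVanishing →
      ∃ (ξ : A.closedForms) (ξN : (A.deform N hN).closedForms),
        (∀ ζ : ModularLieAlgebroid.OneForm E F V, A.IsModularForm η μ ζ ↔ ζ = ξ) ∧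
        (∀ ζ : ModularLieAlgebroid.OneForm E F V,
          (A.deform N hN).IsModularForm η μ ζ ↔ ζ = ξN) ∧
        A.modularClass = A.cls ξ ∧
        (A.deform N hN).modularClass = (A.deform N hN).cls ξN ∧
        (ξN : ModularLieAlgebroid.OneForm E F V) - N.pullback ξ = A.dZero N.trace) := by
  have exists_forms : ∀ (η : ModularLieAlgebroid.TopMultivector E F V)
      (μ : ModularLieAlgebroid.TopForm E M), η.NonVanishing → μ.NonVanishing →
      ∃ (ξ : A.closedForms) (ξN : (A.deform N hN).closedForms),
        (∀ ζ : ModularLieAlgebroid.OneForm E F V, A.IsModularForm η μ ζ ↔ ζ = ξ) ∧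
        (∀ ζ : ModularLieAlgebroid.OneForm E F V,
          (A.deform N hN).IsModularForm η μ ζ ↔ ζ = ξN) ∧
        A.modularClass = A.cls ξ ∧
        (A.deform N hN).modularClass = (A.deform N hN).cls ξN ∧
        (ξN : ModularLieAlgebroid.OneForm E F V) - N.pullback ξ = A.dZero N.trace := by
    intro η μ hη hμ
    obtain ⟨ξ, hξ⟩ := A.exists_modularForm hη hμ
    obtain ⟨ξN, hξN⟩ := (A.deform N hN).exists_modularForm hη hμ
    have h := (hξ ξ).2 rfl
    have h' := (hξN ξN).2 rfl
    exact ⟨ξ, ξN, hξ, hξN, A.modularClass_eq_cls hη hμ h,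
      (A.deform N hN).modularClass_eq_cls hη hμ h',
      ModularLieAlgebroid.LieAlgebroid.IsModularForm.deform_sub_pullback A hη hμ hN h h'⟩
  refine ⟨?_, exists_forms⟩
  obtain ⟨η, hη⟩ := hA
  obtain ⟨μ, hμ⟩ := hM
  obtain ⟨ξ, ξN, -, -, hmod, hmodN, hsub⟩ := exists_forms η μ hη hμ
  have key : ((ξN - (A.deformHom N hN).pullbackClosed ξ : (A.deform N hN).closedForms) :
      ModularLieAlgebroid.OneForm E F V) = A.dZero N.trace := hsub
  -- Closedness of `d_A Tr N` for `A_N` needs no computation: it is a difference of two closed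
  -- forms.
  refine ⟨key ▸ (ξN - (A.deformHom N hN).pullbackClosed ξ).2, ?_⟩
  rw [ModularLieAlgebroid.LieAlgebroid.Hom.relativeModularClass, hmod, hmodN]
  exact congrArg (A.deform N hN).cls (Subtype.ext key)
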